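/- Let $\mathbb{A}$ be a countably infinite set of names, and let $\mathsf{Nom}$ be the category of nominal sets over $\mathbb{A}$ (sets with an action of the group of finite permutations of $\mathbb{A}$ in which every element has a finite support) and equivariant maps. For a nominal set $X$, let $X^{\mathbb{A}}$ be the nominal set of functions $\mathbb{A}\to X$ that are finitely supported with respect to the conjugation action $(\pi\cdot f)(a)=\pi\cdot f(\pi^{-1}(a))$; let $[\mathbb{A}]X$ be the abstraction set, i.e. the quotient of $\mathbb{A}\times X$ by the relation $(a,x)\sim(b,y)$ iff $(a\,c)\cdot x=(b\,c)\cdot y$ for some (equivalently, every) name $c$ that is fresh for $a,b,x,y$, and write $\langle a\rangle x$ for the class of $(a,x)$; let $\mathcal{P}_{\mathsf{fs}}X$ be the nominal set of finitely supported subsets of $X$; and let $2=\{0,1\}$ carry the trivial action. Let $G\colon\mathsf{Nom}\to\mathsf{Nom}$ be the functor $GX=2\times X^{\mathbb{A}}\times[\mathbb{A}]X$. Let $\bar{\mathbb{A}}=\mathbb{A}\cup\{\,|a : a\in\mathbb{A}\}$, let $\bar{\mathbb{A}}^*$ be the nominal set of finite words over $\bar{\mathbb{A}}$ (bar strings) with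 the letterwise action, and let $=_\alpha$ be the least equivalence relation on $\bar{\mathbb{A}}^*$ such that $x|av=_\alpha x|bw$ whenever $a,b\in\mathbb{A}$, $x,v,w\in\bar{\mathbb{A}}^*$ and $\langle a\rangle v=\langle b\rangle w$ in $[\mathbb{A}]\bar{\mathbb{A}}^*$. The quotient $\bar{\mathbb{A}}^*/{=_\alpha}$ is a nominal set under $\pi\cdot[w]=[\pi\cdot w]$, where $[w]$ denotes the class of $w$. Then the nominal set $\mathcal{P}_{\mathsf{fs}}(\bar{\mathbb{A}}^*/{=_\alpha})$ with the structure map $$\tau\colon \mathcal{P}_{\mathsf{fs}}(\bar{\mathbb{A}}^*/{=_\alpha})\to 2\times \mathcal{P}_{\mathsf{fs}}(\bar{\mathbb{A}}^*/{=_\alpha})^{\mathbb{A}}\times[\mathbb{A}]\mathcal{P}_{\mathsf{fs}}(\bar{\mathbb{A}}^*/{=_\alpha}),\qquad \tau(S)=\bigl(b,\ a\mapsto S_a,\ S_{|}\bigr),$$ is a terminal $G$-coalgebra, where $b=1$ if $[\varepsilon]\in S$ and $b=0$ otherwise, $S_a=\{[w] : [aw]\in S\}$, and $S_{|}=\langle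 a\rangle\{[w] : [|aw]\in S\}$ for any name $a$ that is fresh for $S$. In particular, $\tau$ is well defined (the value of $S_{|}$ does not depend on the choice of the fresh name $a$) and equivariant. -/

import Mathlib

open CategoryTheory
open scoped Pointwise

universe u v w

namespace Nominal

/-! ## Nominal sets -/

/-- The group of finite permutations of the set `A` of names. -/
def FinPerm (A : Type u) : Subgroup (Equiv.Perm A) where
  carrier := {π | {a | π a ≠ a}.Finite}
  one_mem' := by simp
  mul_mem' {π ρ} hπ hρ := by
    refine (hπ.union hρ).subset fun a ha => ?_
    by_contra h
    simp only [Set.mem_union, Set.mem_ofPred_eq, not_or, not_not] at h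
    exact ha (by simp [h.2, h.1])
  inv_mem' {π} hπ := by
    refine hπ.subset fun a ha h => ha ?_
    rw [Equiv.Perm.inv_eq_iff_eq]
    exact h.symm

/-- The transposition `(a b)`. -/
noncomputable def swap {A : Type u} (a b : A) : FinPerm A :=
  letI := Classical.decEq A
  ⟨Equiv.swap a b, by
    refine (Set.toFinite {a, b}).subset fun c hc => ?_
    by_contra h
    simp only [Set.mem_insert_iff, Set.mem_singleton_iff, not_or] at h
    exact hc (Equiv.swap_apply_of_ne_of_ne h.1 h.2)⟩

/-- Every element of `X` has a finite support: `X` is a nominal set. -/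
class IsNominal (A : Type u) (X : Type v) [MulAction (FinPerm A) X] : Prop where
  exists_supports : ∀ x : X, ∃ s : Finset A, MulAction.Supports (FinPerm A) (s : Set A) x

/-- The least finite support of `x`, i.e. the intersection of all its finite supports. -/
def supp (A : Type u) {X : Type v} [SMul (FinPerm A) X] (x : X) : Set A :=
  {a | ∀ s : Finset A, MulAction.Supports (FinPerm A) (s : Set A) x → a ∈ s}

/-- `a # x`: the name `a` is fresh for `x`. -/
def Fresh {A : Type u} {X : Type v} [SMul (FinPerm A) X] (a : A) (x : X) : Prop :=
  a ∉ supp A x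

/-! ### Basic facts on transpositions and freshness -/

section Basic

variable {A : Type u} {X : Type v} [MulAction (FinPerm A) X]

theorem smul_name (π : FinPerm A) (a : A) : π • a = π.1 a := rfl

theorem swap_smul_left (a b : A) : swap a b • a = b := by
  classical
  simp [smul_name, swap]

theorem swap_smul_right (a b : A) : swap a b • b = a := by
  classical
  simp [smul_name, swap]

theorem swap_smul_of_ne {a b c : A} (ha : c ≠ a) (hb : c ≠ b) : swap a b • c = c := by
  classical
  simpa [smul_name, swap] using Equiv.swap_apply_of_ne_of_ne ha hb

theorem mul_swap (π : FinPerm A) (a b : A) : π * swap a b = swap (π • a) (π • b) * π := by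
  classical
  apply Subtype.ext
  simpa [swap, smul_name] using Equiv.mul_swap_eq_swap_mul π.1 a b

theorem supports_of_forall {s : Set A} {x : X}
    (h : ∀ π : FinPerm A, (∀ a ∈ s, π • a = a) → π • x = x) :
    MulAction.Supports (FinPerm A) s x := fun π hπ => h π fun _ ha => hπ ha

theorem supports_smul {s : Finset A} {x : X} (h : MulAction.Supports (FinPerm A) (s : Set A) x)
    (π : FinPerm A) : ∃ t : Finset A, (∀ a, a ∈ t ↔ π⁻¹ • a ∈ s) ∧
      MulAction.Supports (FinPerm A) (t : Set A) (π • x) := by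
  classical
  refine ⟨s.image (fun a => π • a), fun a => ?_, fun ρ hρ => ?_⟩
  · simp only [Finset.mem_image]
    constructor
    · rintro ⟨b, hb, rfl⟩
      simpa using hb
    · exact fun ha => ⟨_, ha, by simp⟩
  · have := h (π⁻¹ * ρ * π) fun a ha => by
      have h2 : ρ • π • a = π • a := hρ (Finset.mem_coe.2 (Finset.mem_image_of_mem _ ha))
      rw [mul_smul, mul_smul, h2, inv_smul_smul]
    rw [mul_smul, mul_smul, inv_smul_eq_iff] at this
    exact this

theorem fresh_iff {a : A} {x : X} :
    Fresh a x ↔ ∃ s : Finset A, MulAction.Supports (FinPerm A) (s : Set A) x ∧ a ∉ s := by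
  simp [Fresh, supp]

theorem Fresh.smul {a : A} {x : X} (h : Fresh a x) (π : FinPerm A) : Fresh (π • a) (π • x) := by
  obtain ⟨s, hs, ha⟩ := fresh_iff.1 h
  obtain ⟨t, ht, ht'⟩ := supports_smul hs π
  exact fresh_iff.2 ⟨t, ht', by simpa [ht] using ha⟩

theorem Fresh.map {Y : Type w} [MulAction (FinPerm A) Y] {a : A} {x : X} (h : Fresh a x)
    (f : X →[FinPerm A] Y) : Fresh a (f x) := by
  obtain ⟨s, hs, ha⟩ := fresh_iff.1 h
  exact fresh_iff.2 ⟨s, fun π hπ => by rw [← map_smul, hs π hπ], ha⟩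

theorem swap_smul_of_notMem {s : Finset A} {x : X}
    (h : MulAction.Supports (FinPerm A) (s : Set A) x) {a b : A} (ha : a ∉ s) (hb : b ∉ s) :
    swap a b • x = x :=
  h _ fun _ hc => swap_smul_of_ne (fun e => ha (e ▸ hc)) (fun e => hb (e ▸ hc))

theorem swap_smul_of_fresh [Infinite A] {a b : A} {x : X} (ha : Fresh a x) (hb : Fresh b x) :
    swap a b • x = x := by
  classical
  obtain ⟨s, hs, has⟩ := fresh_iff.1 ha
  obtain ⟨t, ht, hbt⟩ := fresh_iff.1 hb
  obtain ⟨c, hc⟩ := Infinite.exists_notMem_finset (s ∪ t ∪ {a, b})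
  simp only [Finset.mem_union, Finset.mem_insert, Finset.mem_singleton, not_or] at hc
  obtain ⟨⟨hcs, hct⟩, hca, hcb⟩ := hc
  have h1 : swap a c • x = x := swap_smul_of_notMem hs has hcs
  have h2 : swap c b • x = x := swap_smul_of_notMem ht hct hbt
  by_cases hab : a = b
  · subst hab
    rw [show swap a a = (1 : FinPerm A) from Subtype.ext (by simp [swap]; rfl), one_smul]
  · have h3 := mul_swap (swap a c) c b
    rw [swap_smul_right, swap_smul_of_ne (Ne.symm hab) (Ne.symm hcb)] at h3
    have h4 := congrArg (· • x) h3
    simp only [mul_smul, h1, h2] at h4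
    exact h4.symm

theorem exists_fresh_pair [Infinite A] [IsNominal A X] (F : Finset A) (x y : X) :
    ∃ c, c ∉ F ∧ Fresh c x ∧ Fresh c y := by
  classical
  obtain ⟨s, hs⟩ := IsNominal.exists_supports (A := A) x
  obtain ⟨t, ht⟩ := IsNominal.exists_supports (A := A) y
  obtain ⟨c, hc⟩ := Infinite.exists_notMem_finset (F ∪ s ∪ t)
  simp only [Finset.mem_union, not_or] at hc
  exact ⟨c, hc.1.1, fresh_iff.2 ⟨s, hs, hc.1.2⟩, fresh_iff.2 ⟨t, ht, hc.2⟩⟩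

end Basic

/-! ## Abstraction sets -/

/-- `(a, x) ∼ (b, y)` iff `(a c) • x = (b c) • y` for some fresh name `c`. -/
def AbsRel (A : Type u) (X : Type v) [MulAction (FinPerm A) X] (p q : A × X) : Prop :=
  ∃ c : A, c ≠ p.1 ∧ c ≠ q.1 ∧ Fresh c p.2 ∧ Fresh c q.2 ∧
    swap p.1 c • p.2 = swap q.1 c • q.2

theorem swap_conj_of_fresh {A : Type u} {X : Type v} [MulAction (FinPerm A) X] [Infinite A]
    {a c d : A} {x : X} (hc : c ≠ a) (hd : d ≠ a) (hcx : Fresh c x) (hdx : Fresh d x) :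
    swap c d • swap a c • x = swap a d • x := by
  rw [← mul_smul, mul_swap, swap_smul_left, swap_smul_of_ne hc.symm hd.symm, mul_smul,
    swap_smul_of_fresh hcx hdx]

/-- In the definition of `AbsRel`, "some" may be replaced by "all". -/
theorem AbsRel.of_fresh {A : Type u} {X : Type v} [MulAction (FinPerm A) X] [Infinite A]
    {p q : A × X} (h : AbsRel A X p q) {d : A} (h1 : d ≠ p.1) (h2 : d ≠ q.1)
    (h3 : Fresh d p.2) (h4 : Fresh d q.2) : swap p.1 d • p.2 = swap q.1 d • q.2 := by
  obtain ⟨c, c1, c2, c3, c4, e⟩ := h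
  rw [← swap_conj_of_fresh c1 h1 c3 h3, e, swap_conj_of_fresh c2 h2 c4 h4]

theorem AbsRel.smul {A : Type u} {X : Type v} [MulAction (FinPerm A) X]
    {p q : A × X} (h : AbsRel A X p q) (π : FinPerm A) : AbsRel A X (π • p) (π • q) := by
  obtain ⟨c, c1, c2, c3, c4, e⟩ := h
  refine ⟨π • c, ?_, ?_, c3.smul π, c4.smul π, ?_⟩
  · simpa using c1
  · simpa using c2
  · simp only [Prod.smul_fst, Prod.smul_snd]
    rw [← mul_smul, ← mul_smul, ← mul_swap, ← mul_swap, mul_smul, mul_smul, e]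

theorem AbsRel.map {A : Type u} {X : Type v} {Y : Type w} [MulAction (FinPerm A) X]
    [MulAction (FinPerm A) Y] (f : X →[FinPerm A] Y) {p q : A × X} (h : AbsRel A X p q) :
    AbsRel A Y (p.1, f p.2) (q.1, f q.2) := by
  obtain ⟨c, c1, c2, c3, c4, e⟩ := h
  exact ⟨c, c1, c2, c3.map f, c4.map f, by rw [← map_smul, ← map_smul, e]⟩

section Abs

variable (A : Type u) [Infinite A] (X : Type v) [MulAction (FinPerm A) X] [IsNominal A X]

instance absSetoid : Setoid (A × X) where
  r := AbsRel A X
  iseqv := by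
    classical
    refine ⟨fun p => ?_, fun h => ?_, fun {p q r} h h' => ?_⟩
    · obtain ⟨c, h1, h2, h3⟩ := exists_fresh_pair {p.1} p.2 p.2
      simp only [Finset.mem_singleton] at h1
      exact ⟨c, h1, h1, h2, h2, rfl⟩
    · obtain ⟨c, c1, c2, c3, c4, e⟩ := h
      exact ⟨c, c2, c1, c4, c3, e.symm⟩
    · obtain ⟨s, hs⟩ := IsNominal.exists_supports (A := A) q.2
      obtain ⟨d, h1, h2, h3⟩ := exists_fresh_pair ({p.1, q.1, r.1} ∪ s) p.2 r.2
      simp only [Finset.mem_union, Finset.mem_insert, Finset.mem_singleton, not_or] at h1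
      obtain ⟨⟨d1, d2, d3⟩, d4⟩ := h1
      have d5 : Fresh d q.2 := fresh_iff.2 ⟨s, hs, d4⟩
      exact ⟨d, d1, d3, h2, h3, (h.of_fresh d1 d2 h2 d5).trans (h'.of_fresh d2 d3 d5 h3)⟩

/-- The abstraction set `[A]X`. -/
def Abs : Type (max u v) := Quotient (absSetoid A X)

variable {A X}

/-- The element `⟨a⟩x` of `[A]X`. -/
def abs (a : A) (x : X) : Abs A X := Quotient.mk (absSetoid A X) (a, x)

instance : MulAction (FinPerm A) (Abs A X) where
  smul π := Quotient.map (fun p => π • p) fun _ _ h => AbsRel.smul h π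
  one_smul := by
    rintro ⟨p⟩
    exact congrArg (Quotient.mk _) (one_smul _ p)
  mul_smul π ρ := by
    rintro ⟨p⟩
    exact congrArg (Quotient.mk _) (mul_smul π ρ p)

theorem smul_abs (π : FinPerm A) (a : A) (x : X) : π • abs a x = abs (π • a) (π • x) := rfl

instance : IsNominal A (Abs A X) where
  exists_supports := by
    classical
    rintro ⟨a, x⟩
    obtain ⟨s, hs⟩ := IsNominal.exists_supports (A := A) x
    refine ⟨insert a s, supports_of_forall fun π hπ => ?_⟩
    change abs (π • a) (π • x) = abs a x
    rw [hπ a (by simp), hs π fun b hb => hπ b (by simpa using Or.inr hb)]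

/-- The equivariant map `[A]f : ⟨a⟩x ↦ ⟨a⟩f(x)`. -/
def Abs.map {Y : Type w} [MulAction (FinPerm A) Y] [IsNominal A Y] (f : X →[FinPerm A] Y) :
    Abs A X →[FinPerm A] Abs A Y where
  toFun := Quotient.map (fun p => (p.1, f p.2)) fun _ _ h => AbsRel.map f h
  map_smul' π := by
    rintro ⟨a, x⟩
    change abs (π • a) (f (π • x)) = abs (π • a) (π • f x)
    rw [map_smul]

end Abs

/-! ## Exponentials by the set of names -/

section Exp

variable (A : Type u) (X : Type v) [MulAction (FinPerm A) X]

/-- The action on functions `A → X` by conjugation, `(π • f) a = π • f (π⁻¹ • a)`. -/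
def conjAct (π : FinPerm A) (f : A → X) : A → X := fun a => π • f (π⁻¹ • a)

/-- The exponential `X^A` in the category of nominal sets: all functions `A → X` that are finitely
supported with respect to the conjugation action. -/
structure Exp : Type (max u v) where
  toFun : A → X
  exists_supports : ∃ s : Finset A, ∀ π : FinPerm A, (∀ a ∈ s, π • a = a) →
    conjAct A X π toFun = toFun

variable {A X}

instance : CoeFun (Exp A X) (fun _ => A → X) := ⟨Exp.toFun⟩

@[ext]
theorem Exp.ext {f g : Exp A X} (h : ∀ a, f a = g a) : f = g := by
  cases f; cases g; congr; exact funext h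

theorem conjAct_mul (π ρ : FinPerm A) (f : A → X) :
    conjAct A X (π * ρ) f = conjAct A X π (conjAct A X ρ f) := by
  funext a
  simp [conjAct, mul_smul]

instance : MulAction (FinPerm A) (Exp A X) where
  smul π f := ⟨conjAct A X π f, by
    classical
    obtain ⟨s, hs⟩ := f.exists_supports
    refine ⟨s.image (fun a => π • a), fun ρ hρ => ?_⟩
    have h := hs (π⁻¹ * ρ * π) fun a ha => by
      rw [mul_smul, mul_smul, hρ _ (Finset.mem_image_of_mem _ ha), inv_smul_smul]
    rw [← conjAct_mul, show ρ * π = π * (π⁻¹ * ρ * π) by group, conjAct_mul, h]⟩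
  one_smul f := Exp.ext fun a => by
    change conjAct A X 1 f a = f a
    simp [conjAct]
  mul_smul π ρ f := Exp.ext fun a => congrFun (conjAct_mul π ρ f) a

theorem Exp.smul_apply (π : FinPerm A) (f : Exp A X) (a : A) : (π • f) a = π • f (π⁻¹ • a) := rfl

instance : IsNominal A (Exp A X) where
  exists_supports f := by
    obtain ⟨s, hs⟩ := f.exists_supports
    exact ⟨s, supports_of_forall fun π hπ => Exp.ext fun a => congrFun (hs π hπ) a⟩

/-- The equivariant map `h^A : f ↦ h ∘ f`. -/
def Exp.map {Y : Type w} [MulAction (FinPerm A) Y] (h : X →[FinPerm A] Y) :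
    Exp A X →[FinPerm A] Exp A Y where
  toFun f := ⟨fun a => h (f a), by
    obtain ⟨s, hs⟩ := f.exists_supports
    refine ⟨s, fun π hπ => funext fun a => ?_⟩
    have := congrFun (hs π hπ) a
    simp only [conjAct] at this ⊢
    rw [← map_smul, this]⟩
  map_smul' π f := Exp.ext fun a => map_smul h π (f (π⁻¹ • a))

end Exp

/-! ## Products with the discrete two-element nominal set -/

/-- The nominal set `2 = {false, true}` with the trivial action. -/
inductive Two : Type
  | zero
  | one

instance (A : Type u) : MulAction (FinPerm A) Two where
  smul _ b := b
  one_smul _ := rfl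
  mul_smul _ _ _ := rfl

instance (A : Type u) : IsNominal A Two where
  exists_supports _ := ⟨∅, fun _ _ => rfl⟩

instance (A : Type u) (X : Type v) (Y : Type w) [MulAction (FinPerm A) X]
    [MulAction (FinPerm A) Y] [IsNominal A X] [IsNominal A Y] : IsNominal A (X × Y) where
  exists_supports p := by
    classical
    obtain ⟨s, hs⟩ := IsNominal.exists_supports (A := A) p.1
    obtain ⟨t, ht⟩ := IsNominal.exists_supports (A := A) p.2
    exact ⟨s ∪ t, supports_of_forall fun π hπ => Prod.ext
      (hs π fun a ha => hπ a (by simpa using Or.inl ha))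
      (ht π fun a ha => hπ a (by simpa using Or.inr ha))⟩

/-! ## Finitely supported subsets -/

section Pfs

variable (A : Type u) (X : Type v) [MulAction (FinPerm A) X]

/-- The finitely supported subsets of `X`, for the action `π • S = {π • x | x ∈ S}`. -/
def Pfs : Type v :=
  {S : Set X // ∃ s : Finset A, MulAction.Supports (FinPerm A) (s : Set A) S}

variable {A X}

instance : Membership X (Pfs A X) := ⟨fun S x => x ∈ S.1⟩

instance : MulAction (FinPerm A) (Pfs A X) where
  smul π S := ⟨π • S.1, by
    obtain ⟨s, hs⟩ := S.2
    obtain ⟨t, -, ht⟩ := supports_smul hs π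
    exact ⟨t, ht⟩⟩
  one_smul S := Subtype.ext (one_smul _ S.1)
  mul_smul π ρ S := Subtype.ext (mul_smul π ρ S.1)

instance : IsNominal A (Pfs A X) where
  exists_supports S := by
    obtain ⟨s, hs⟩ := S.2
    exact ⟨s, fun π hπ => Subtype.ext (hs π hπ)⟩

end Pfs

/-! ## The category of nominal sets -/

/-- A nominal set over the set `A` of names. -/
structure Nom (A : Type u) : Type (u + 1) where
  carrier : Type u
  [action : MulAction (FinPerm A) carrier]
  [nominal : IsNominal A carrier]

namespace Nom

instance (A : Type u) : CoeSort (Nom A) (Type u) := ⟨Nom.carrier⟩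

attribute [instance] Nom.action Nom.nominal

/-- Morphisms of nominal sets are the equivariant maps. -/
instance (A : Type u) : Category (Nom A) where
  Hom X Y := X →[FinPerm A] Y
  id X := MulActionHom.id (FinPerm A)
  comp f g := MulActionHom.comp g f

instance (A : Type u) : ConcreteCategory (Nom A) (fun X Y => X →[FinPerm A] Y) where
  hom f := f
  ofHom f := f

end Nom

/-- The functor `G X = 2 × X^A × [A]X`. -/
def G (A : Type u) [Infinite A] : Nom A ⥤ Nom A where
  obj X := ⟨Two × Exp A X × Abs A X⟩
  map {X Y} f := ({
    toFun := fun p => (p.1, Exp.map f p.2.1, Abs.map f p.2.2)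
    map_smul' := fun π p => by
      change (π • p.1, Exp.map f (π • p.2.1), Abs.map f (π • p.2.2)) = _
      rw [map_smul, map_smul]
      rfl } : (Two × Exp A X × Abs A X) →[FinPerm A] (Two × Exp A Y × Abs A Y))
  map_id X := by
    refine DFunLike.ext (F := (Two × Exp A X × Abs A X) →[FinPerm A] _) _ _ ?_
    rintro ⟨b, f, ⟨a, x⟩⟩
    rfl
  map_comp {X Y Z} f g := by
    refine DFunLike.ext (F := (Two × Exp A X × Abs A X) →[FinPerm A]
      (Two × Exp A Z × Abs A Z)) _ _ ?_
    rintro ⟨b, h, ⟨a, x⟩⟩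
    rfl

/-! ## Bar strings modulo α-equivalence -/

/-- The alphabet of bar strings: names `a` and barred names `|a`. -/
inductive BarLetter (A : Type u) : Type u
  | name (a : A)
  | bar (a : A)

/-- The name underlying a letter. -/
def BarLetter.toName {A : Type u} : BarLetter A → A
  | name a => a
  | bar a => a

section Bar

variable {A : Type u}

instance : MulAction (FinPerm A) (BarLetter A) where
  smul π
    | .name a => .name (π • a)
    | .bar a => .bar (π • a)
  one_smul := by rintro (a | a) <;> rfl
  mul_smul π ρ := by rintro (a | a) <;> rfl

theorem BarLetter.smul_name (π : FinPerm A) (a : A) : π • name a = name (π • a) := rfl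

theorem BarLetter.smul_bar (π : FinPerm A) (a : A) : π • bar a = bar (π • a) := rfl

theorem BarLetter.smul_eq {π : FinPerm A} {σ : BarLetter A} (h : π • σ.toName = σ.toName) :
    π • σ = σ := by
  cases σ with
  | name a => exact congrArg name h
  | bar a => exact congrArg bar h

variable (A) in
/-- Bar strings are finite words over `BarLetter A`. -/
abbrev BarString : Type u := List (BarLetter A)

/-- The pointwise action on bar strings. -/
instance : MulAction (FinPerm A) (BarString A) where
  smul π w := w.map (fun σ => π • σ)
  one_smul w := by
    change w.map _ = w
    simp
  mul_smul π ρ w := by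
    change w.map _ = (w.map _).map _
    simp [mul_smul]

theorem smul_nil (π : FinPerm A) : π • ([] : BarString A) = [] := rfl

theorem smul_cons (π : FinPerm A) (σ : BarLetter A) (w : BarString A) :
    π • (σ :: w) = (π • σ) :: (π • w) := rfl

theorem smul_append (π : FinPerm A) (v w : BarString A) :
    π • (v ++ w) = π • v ++ π • w := List.map_append

instance : IsNominal A (BarString A) where
  exists_supports w := by
    classical
    induction w with
    | nil => exact ⟨∅, fun π _ => rfl⟩
    | cons σ w ih =>
      obtain ⟨s, hs⟩ := ih
      refine ⟨insert σ.toName s, supports_of_forall fun π hπ => ?_⟩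
      rw [smul_cons, hs π fun b hb => hπ b (by simpa using Or.inr hb),
        BarLetter.smul_eq (hπ _ (by simp))]

variable [Infinite A]

/-- A single renaming step: `x|av` and `x|bw` are related if `⟨a⟩v = ⟨b⟩w`. -/
inductive AlphaStep : BarString A → BarString A → Prop
  | rename (x v w : BarString A) (a b : A) (h : abs a v = abs b w) :
      AlphaStep (x ++ .bar a :: v) (x ++ .bar b :: w)

theorem AlphaStep.smul (π : FinPerm A) {v w : BarString A} (h : AlphaStep v w) :
    AlphaStep (π • v) (π • w) := by
  obtain ⟨x, v, w, a, b, h⟩ := h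
  rw [smul_append, smul_append, smul_cons, smul_cons]
  exact .rename _ _ _ _ _ (by rw [← smul_abs, h, smul_abs])

variable (A) in
/-- α-equivalence of bar strings: the equivalence relation generated by `AlphaStep`. -/
def alphaSetoid : Setoid (BarString A) := Relation.EqvGen.setoid AlphaStep

theorem alpha_smul (π : FinPerm A) {v w : BarString A} (h : alphaSetoid A v w) :
    alphaSetoid A (π • v) (π • w) := by
  induction h with
  | rel _ _ h => exact .rel _ _ (h.smul π)
  | refl _ => exact .refl _
  | symm _ _ _ ih => exact .symm _ _ ih
  | trans _ _ _ _ _ ih ih' => exact .trans _ _ _ ih ih'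

variable (A) in
/-- The set of bar strings modulo α-equivalence. -/
def BarClass : Type u := Quotient (alphaSetoid A)

/-- The α-equivalence class of a bar string. -/
def cls (w : BarString A) : BarClass A := Quotient.mk (alphaSetoid A) w

instance : MulAction (FinPerm A) (BarClass A) where
  smul π := Quotient.map (fun w => π • w) fun _ _ h => alpha_smul π h
  one_smul := by
    rintro ⟨w⟩
    exact congrArg cls (one_smul _ w)
  mul_smul π ρ := by
    rintro ⟨w⟩
    exact congrArg cls (mul_smul π ρ w)

theorem smul_cls (π : FinPerm A) (w : BarString A) : π • cls w = cls (π • w) := rfl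

instance : IsNominal A (BarClass A) where
  exists_supports := by
    rintro ⟨w⟩
    obtain ⟨s, hs⟩ := IsNominal.exists_supports (A := A) w
    exact ⟨s, fun π hπ => congrArg cls (hs π hπ)⟩

/-! ## Bar languages -/

/-- The set `{[w] | [σw] ∈ S}`, for a letter `σ` (either `a` or `|a`). -/
def derivSet (σ : BarLetter A) (S : Set (BarClass A)) : Set (BarClass A) :=
  {c | ∃ w : BarString A, c = cls w ∧ cls (σ :: w) ∈ S}

theorem smul_derivSet (π : FinPerm A) (σ : BarLetter A) (S : Set (BarClass A)) :
    π • derivSet σ S = derivSet (π • σ) (π • S) := by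
  ext c
  simp only [Set.mem_smul_set_iff_inv_smul_mem, derivSet, Set.mem_ofPred_eq]
  constructor
  · rintro ⟨w, hc, hw⟩
    refine ⟨π • w, by rw [← smul_cls, ← hc, smul_inv_smul], ?_⟩
    rwa [← smul_cons, smul_cls, inv_smul_smul]
  · rintro ⟨w, rfl, hw⟩
    refine ⟨π⁻¹ • w, rfl, ?_⟩
    rwa [smul_cls, smul_cons, inv_smul_smul] at hw

/-- The finitely supported set `{[w] | [σw] ∈ S}`, for a letter `σ` (either `a` or `|a`). -/
def deriv (σ : BarLetter A) (S : Pfs A (BarClass A)) : Pfs A (BarClass A) :=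
  ⟨derivSet σ S.1, by
    classical
    obtain ⟨s, hs⟩ := S.2
    refine ⟨insert σ.toName s, supports_of_forall fun π hπ => ?_⟩
    rw [smul_derivSet, BarLetter.smul_eq (hπ _ (by simp)),
      hs π fun b hb => hπ b (by simpa using Or.inr hb)]⟩

variable (A) in
/-- The nominal set of bar languages, i.e. finitely supported sets of classes of bar strings. -/
def barLanguages : Nom A := ⟨Pfs A (BarClass A)⟩

end Bar

end Nominal

/-! A state `x` of a coalgebra reads a bar string letter by letter. A plain name `a` leads to the
value at `a` of the function component. For `|a` followed by `w`, the obstacle is that the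
abstraction component need not have a representative with bound name `a`, since `a` may be free in
it. So it is written as `⟨c⟩y` with `c ≠ a` fresh for `w`, and reading continues from `(a c) • y`.
By equivariance this says that `y` accepts `(a c) • w`: the word has been replaced by its α-variant
`|c((a c)w)`.

Acceptance does not depend on the choice of `⟨c⟩y` (`accepts_bar_iff`) and is invariant under
α-equivalence (`accepts_of_alphaStep`), so each state accepts a bar language, and equivariance makes
that language finitely supported. This assignment is a homomorphism (`languageStr_behaviour`). It is
the only one (`eq_behaviour`): the homomorphism equations determine membership of `[w]` by induction
on `w`. -/

namespace Nominal

/-! ### Choosing bound names in abstraction sets -/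

section Abstraction

variable {A : Type u} {X : Type v} [MulAction (FinPerm A) X]

theorem swap_smul_swap_smul (a b : A) (x : X) : swap a b • swap a b • x = x := by
  classical
  rw [← mul_smul, show swap a b * swap a b = 1 from
    Subtype.ext (by simp [swap]), one_smul]

theorem smul_swap_smul (π : FinPerm A) (a b : A) (x : X) :
    π • swap a b • x = swap (π • a) (π • b) • π • x := by
  rw [← mul_smul, mul_swap, mul_smul]

variable [Infinite A] [IsNominal A X]

theorem abs_eq_iff {a b : A} {x y : X} : abs a x = abs b y ↔ AbsRel A X (a, x) (b, y) :=
  ⟨fun h => Quotient.exact h, fun h => Quotient.sound h⟩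

/-- Moving either bound name to a third fresh name `d` gives `(a d) • x`, because `(c d)` conjugates
`(a c)` to `(a d)` and fixes `x`. -/
theorem abs_eq_abs_swap {a c : A} {x : X} (hc : c ≠ a) (hx : Fresh c x) :
    abs a x = abs c (swap a c • x) := by
  classical
  obtain ⟨d, hd, h1, h2⟩ := exists_fresh_pair {a, c} x (swap a c • x)
  simp only [Finset.mem_insert, Finset.mem_singleton, not_or] at hd
  exact abs_eq_iff.2 ⟨d, hd.1, hd.2, h1, h2, (swap_conj_of_fresh hc hd.1 hx h1).symm⟩

theorem abs_right_injective {a : A} {x y : X} (h : abs a x = abs a y) : x = y := by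
  obtain ⟨c, -, -, -, -, e⟩ := abs_eq_iff.1 h
  exact MulAction.injective _ e

/-- Every abstraction can be written with a representative name that avoids a given finite set and
is fresh for two given elements. -/
theorem exists_eq_abs_of_fresh {Y : Type w} {Z : Type*} [MulAction (FinPerm A) Y] [IsNominal A Y]
    [MulAction (FinPerm A) Z] [IsNominal A Z] (t : Abs A X) (F : Finset A) (y : Y) (z : Z) :
    ∃ (c : A) (x : X), c ∉ F ∧ Fresh c y ∧ Fresh c z ∧ t = abs c x := by
  classical
  obtain ⟨b, x⟩ := t
  obtain ⟨s, hs⟩ := IsNominal.exists_supports (A := A) y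
  obtain ⟨s', hs'⟩ := IsNominal.exists_supports (A := A) z
  obtain ⟨c, hc, hx, -⟩ := exists_fresh_pair (insert b F ∪ s ∪ s') x x
  simp only [Finset.mem_union, Finset.mem_insert, not_or] at hc
  obtain ⟨⟨⟨h1, h2⟩, h3⟩, h4⟩ := hc
  exact ⟨c, _, h2, fresh_iff.2 ⟨s, hs, h3⟩, fresh_iff.2 ⟨s', hs', h4⟩, abs_eq_abs_swap h1 hx⟩

theorem Abs.map_abs {Y : Type w} [MulAction (FinPerm A) Y] [IsNominal A Y] (f : X →[FinPerm A] Y)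
    (a : A) (x : X) : Abs.map f (abs a x) = abs a (f x) := rfl

end Abstraction

/-! ### The coalgebra structure on bar languages -/

section BarLanguage

variable {A : Type u}

theorem Pfs.ext {X : Type v} [MulAction (FinPerm A) X] {S T : Pfs A X}
    (h : ∀ x, x ∈ S ↔ x ∈ T) : S = T :=
  Subtype.ext (Set.ext h)

theorem Pfs.smul_mem_smul {X : Type v} [MulAction (FinPerm A) X] {S : Pfs A X} (π : FinPerm A)
    {x : X} : π • x ∈ π • S ↔ x ∈ S :=
  Set.smul_mem_smul_set_iff

theorem Pfs.mem_smul {X : Type v} [MulAction (FinPerm A) X] {S : Pfs A X} (π : FinPerm A) {x : X} :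
    x ∈ π • S ↔ π⁻¹ • x ∈ S :=
  Set.mem_smul_set_iff_inv_smul_mem

variable [Infinite A]

theorem alpha_cons (σ : BarLetter A) {v w : BarString A} (h : alphaSetoid A v w) :
    alphaSetoid A (σ :: v) (σ :: w) := by
  induction h with
  | rel _ _ h =>
    obtain ⟨x, v, w, a, b, h⟩ := h
    exact .rel _ _ (.rename (σ :: x) v w a b h)
  | refl _ => exact .refl _
  | symm _ _ _ ih => exact .symm _ _ ih
  | trans _ _ _ _ _ ih ih' => exact .trans _ _ _ ih ih'

theorem cls_bar_eq {a c : A} {w : BarString A} (hc : c ≠ a) (hw : Fresh c w) :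
    cls (.bar a :: w) = cls (.bar c :: (swap a c • w)) :=
  Quotient.sound (.rel _ _ (.rename [] _ _ _ _ (abs_eq_abs_swap hc hw)))

/-- `derivSet` asks only for some representative of the class; α-equivalence is preserved by
prefixing a letter, so any representative will do. -/
theorem cls_mem_deriv {σ : BarLetter A} {S : Pfs A (BarClass A)} {w : BarString A} :
    cls w ∈ deriv σ S ↔ cls (σ :: w) ∈ S := by
  constructor
  · rintro ⟨v, hv, h⟩
    rwa [show cls (σ :: w) = cls (σ :: v) from
      Quotient.sound (alpha_cons σ (Quotient.exact hv))]
  · exact fun h => ⟨w, rfl, h⟩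

theorem smul_deriv (π : FinPerm A) (σ : BarLetter A) (S : Pfs A (BarClass A)) :
    π • deriv σ S = deriv (π • σ) (π • S) :=
  Subtype.ext (smul_derivSet π σ S.1)

/-- For a further fresh `c`, the swaps `(a c)` and `(b c)` both fix `S`, so they carry the two
derivatives to the same one, along `|c`. This makes the third component of the structure map well
defined. -/
theorem abs_deriv_bar_eq {a b : A} {S : Pfs A (BarClass A)} (ha : Fresh a S) (hb : Fresh b S) :
    abs a (deriv (.bar a) S) = abs b (deriv (.bar b) S) := by
  classical
  obtain ⟨s, hs⟩ := IsNominal.exists_supports (A := A) S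
  obtain ⟨c, hc, h1, h2⟩ := exists_fresh_pair ({a, b} ∪ s) (deriv (.bar a) S) (deriv (.bar b) S)
  simp only [Finset.mem_union, Finset.mem_insert, Finset.mem_singleton, not_or] at hc
  obtain ⟨⟨ca, cb⟩, cs⟩ := hc
  have hcS : Fresh c S := fresh_iff.2 ⟨s, hs, cs⟩
  refine abs_eq_iff.2 ⟨c, ca, cb, h1, h2, ?_⟩
  simp only [smul_deriv, BarLetter.smul_bar, swap_smul_left, swap_smul_of_fresh ha hcS,
    swap_smul_of_fresh hb hcS]

theorem exists_fresh (S : Pfs A (BarClass A)) : ∃ a : A, Fresh a S :=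
  let ⟨a, _, h, _⟩ := exists_fresh_pair ∅ S S
  ⟨a, h⟩

open Classical in
/-- The truth value of `[ε] ∈ S`. -/
noncomputable def acceptsEmpty (S : Pfs A (BarClass A)) : Two :=
  if cls [] ∈ S then .one else .zero

theorem acceptsEmpty_eq_one {S : Pfs A (BarClass A)} : acceptsEmpty S = .one ↔ cls [] ∈ S := by
  unfold acceptsEmpty
  split_ifs with h <;> simp [h]

theorem Two.ext_one {b b' : Two} (h : b = .one ↔ b' = .one) : b = b' := by
  cases b <;> cases b' <;> simp_all

/-- The function `a ↦ S_a`. -/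
def nameDeriv (S : Pfs A (BarClass A)) : Exp A (Pfs A (BarClass A)) where
  toFun a := deriv (.name a) S
  exists_supports := by
    obtain ⟨s, hs⟩ := IsNominal.exists_supports (A := A) S
    refine ⟨s, fun π hπ => funext fun a => ?_⟩
    rw [conjAct, smul_deriv, BarLetter.smul_name, smul_inv_smul, hs π fun _ h => hπ _ h]

/-- The abstraction `⟨a⟩S_{|a}` for a fresh name `a`. -/
noncomputable def barDeriv (S : Pfs A (BarClass A)) : Abs A (Pfs A (BarClass A)) :=
  abs (exists_fresh S).choose (deriv (.bar (exists_fresh S).choose) S)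

theorem barDeriv_eq {S : Pfs A (BarClass A)} {a : A} (ha : Fresh a S) :
    barDeriv S = abs a (deriv (.bar a) S) :=
  abs_deriv_bar_eq (exists_fresh S).choose_spec ha

variable (A) in
/-- The structure map `S ↦ ([ε] ∈ S, a ↦ S_a, ⟨a⟩S_{|a})`. -/
noncomputable def languageStr : Pfs A (BarClass A) →[FinPerm A]
    Two × Exp A (Pfs A (BarClass A)) × Abs A (Pfs A (BarClass A)) where
  toFun S := (acceptsEmpty S, nameDeriv S, barDeriv S)
  map_smul' π S := by
    refine Prod.ext (Two.ext_one ?_) (Prod.ext (Exp.ext fun a => ?_) ?_)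
    · change acceptsEmpty (π • S) = .one ↔ acceptsEmpty S = .one
      rw [acceptsEmpty_eq_one, acceptsEmpty_eq_one, Pfs.mem_smul, smul_cls, smul_nil]
    · change deriv (.name a) (π • S) = π • deriv (.name (π⁻¹ • a)) S
      rw [smul_deriv, BarLetter.smul_name, smul_inv_smul]
    · change barDeriv (π • S) = π • barDeriv S
      -- The names chosen for `S` and `π • S` are unrelated; both are traded for a fresh `a` and its
      -- image `π • a`.
      obtain ⟨a, ha⟩ := exists_fresh S
      rw [barDeriv_eq ha, barDeriv_eq (ha.smul π), smul_abs, smul_deriv, BarLetter.smul_bar]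

end BarLanguage

/-! ### Acceptance and the unique homomorphism -/

section Behaviour

variable {A : Type u} [Infinite A] {X : Type v} [MulAction (FinPerm A) X] [IsNominal A X]
  (γ : X →[FinPerm A] Two × Exp A X × Abs A X)

/-- The state `x` of the coalgebra `γ` accepts a bar string. -/
def Accepts : BarString A → X → Prop
  | [], x => (γ x).1 = .one
  | .name a :: w, x => Accepts w ((γ x).2.1 a)
  | .bar a :: w, x => ∃ (c : A) (y : X), c ≠ a ∧ Fresh c w ∧ (γ x).2.2 = abs c y ∧
      Accepts w (swap a c • y)

theorem Accepts.smul {w : BarString A} {x : X} (h : Accepts γ w x) (π : FinPerm A) :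
    Accepts γ (π • w) (π • x) := by
  induction w generalizing x with
  | nil =>
    change (γ (π • x)).1 = .one
    rw [map_smul]
    exact h
  | cons σ w ih =>
    cases σ with
    | name a =>
      change Accepts γ (π • w) ((γ (π • x)).2.1 (π • a))
      rw [map_smul]
      have e : (π • γ x).2.1 (π • a) = π • (γ x).2.1 a := by
        rw [Prod.smul_snd, Prod.smul_fst, Exp.smul_apply, inv_smul_smul]
      rw [e]
      exact ih h
    | bar a =>
      obtain ⟨c, y, ca, cw, e, h⟩ := h
      refine ⟨π • c, π • y, ?_, cw.smul π, ?_, ?_⟩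
      · simpa using ca
      · rw [map_smul, Prod.smul_snd, Prod.smul_snd, e, smul_abs]
      · rw [← smul_swap_smul]
        exact ih h

theorem accepts_smul_iff {w : BarString A} {x : X} (π : FinPerm A) :
    Accepts γ (π • w) (π • x) ↔ Accepts γ w x :=
  ⟨fun h => by simpa using h.smul γ π⁻¹, fun h => h.smul γ π⟩

theorem accepts_swap_smul_iff {w : BarString A} {x : X} (a c : A) :
    Accepts γ w (swap a c • x) ↔ Accepts γ (swap a c • w) x := by
  rw [← accepts_smul_iff γ (swap a c), swap_smul_swap_smul]

/-- The existential in the bar clause is equally a universal: two admissible representatives are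
compared at a common fresh name `d`. -/
theorem accepts_bar_iff {w : BarString A} {x y : X} {a c : A} (ca : c ≠ a) (cw : Fresh c w)
    (e : (γ x).2.2 = abs c y) :
    Accepts γ (.bar a :: w) x ↔ Accepts γ w (swap a c • y) := by
  classical
  refine ⟨fun ⟨c', y', ca', cw', e', h⟩ => ?_, fun h => ⟨c, y, ca, cw, e, h⟩⟩
  obtain ⟨s, hs⟩ := IsNominal.exists_supports (A := A) w
  obtain ⟨d, hd, hy, hy'⟩ := exists_fresh_pair ({a, c, c'} ∪ s) y y'
  simp only [Finset.mem_union, Finset.mem_insert, Finset.mem_singleton, not_or] at hd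
  obtain ⟨⟨da, dc, dc'⟩, ds⟩ := hd
  have dw : Fresh d w := fresh_iff.2 ⟨s, hs, ds⟩
  -- Both conditions now concern the same word `(a d) • w`, read from `(c d) • y` and from `(c' d) •
  -- y'`; these states agree since `⟨c⟩y = ⟨c'⟩y'`.
  rw [accepts_swap_smul_iff, ← accepts_smul_iff γ (swap c d), swap_conj_of_fresh ca da cw dw]
  rw [accepts_swap_smul_iff, ← accepts_smul_iff γ (swap c' d), swap_conj_of_fresh ca' da cw' dw] at h
  rwa [(abs_eq_iff.1 (e.symm.trans e')).of_fresh dc dc' hy hy']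

/-- This covers `c = a`, which the bar clause excludes: the swap used to rename the representative
to a fresh name cancels the swap used in reading. -/
theorem accepts_bar_self_iff {w : BarString A} {x y : X} {a : A} (e : (γ x).2.2 = abs a y) :
    Accepts γ (.bar a :: w) x ↔ Accepts γ w y := by
  classical
  obtain ⟨s, hs⟩ := IsNominal.exists_supports (A := A) w
  obtain ⟨c, hc, hy, -⟩ := exists_fresh_pair ({a} ∪ s) y y
  simp only [Finset.mem_union, Finset.mem_singleton, not_or] at hc
  rw [accepts_bar_iff γ hc.1 (fresh_iff.2 ⟨s, hs, hc.2⟩) (e.trans (abs_eq_abs_swap hc.1 hy)),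
    swap_smul_swap_smul]

theorem accepts_of_alphaStep {v w : BarString A} (h : AlphaStep v w) (x : X) :
    Accepts γ v x ↔ Accepts γ w x := by
  classical
  obtain ⟨u, v, w, a, b, h⟩ := h
  induction u generalizing x with
  | nil =>
    -- One representative serves both words, so `y` reads `(a c) • v` and `(b c) • w`, which
    -- coincide as `⟨a⟩v = ⟨b⟩w`.
    obtain ⟨c, y, hc, cv, cw, e⟩ := exists_eq_abs_of_fresh (γ x).2.2 {a, b} v w
    simp only [Finset.mem_insert, Finset.mem_singleton, not_or] at hc
    obtain ⟨ca, cb⟩ := hc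
    change Accepts γ (.bar a :: v) x ↔ Accepts γ (.bar b :: w) x
    rw [accepts_bar_iff γ ca cv e, accepts_bar_iff γ cb cw e, accepts_swap_smul_iff,
      accepts_swap_smul_iff, (abs_eq_iff.1 h).of_fresh ca cb cv cw]
  | cons σ u ih =>
    cases σ with
    | name c => exact ih _
    | bar d =>
      obtain ⟨c, y, cd, h1, h2, e⟩ := exists_eq_abs_of_fresh (γ x).2.2 {d}
        (u ++ .bar a :: v) (u ++ .bar b :: w)
      exact (accepts_bar_iff γ (by simpa using cd) h1 e).trans ((ih _).trans
        (accepts_bar_iff γ (by simpa using cd) h2 e).symm)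

theorem accepts_of_alpha {v w : BarString A} (h : alphaSetoid A v w) (x : X) :
    Accepts γ v x ↔ Accepts γ w x := by
  induction h with
  | rel _ _ h => exact accepts_of_alphaStep γ h x
  | refl _ => exact Iff.rfl
  | symm _ _ _ ih => exact ih.symm
  | trans _ _ _ _ _ ih ih' => exact ih.trans ih'

/-- The set of classes of bar strings accepted by `x`. -/
def acceptedSet (x : X) : Set (BarClass A) := {c | ∃ w, c = cls w ∧ Accepts γ w x}

theorem cls_mem_acceptedSet {w : BarString A} {x : X} :
    cls w ∈ acceptedSet γ x ↔ Accepts γ w x :=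
  ⟨fun ⟨_, e, h⟩ => (accepts_of_alpha γ (Quotient.exact e) x).2 h, fun h => ⟨w, rfl, h⟩⟩

theorem smul_acceptedSet (π : FinPerm A) (x : X) :
    π • acceptedSet γ x = acceptedSet γ (π • x) := by
  ext ⟨w⟩
  change cls w ∈ _ ↔ cls w ∈ _
  rw [Set.mem_smul_set_iff_inv_smul_mem, smul_cls, cls_mem_acceptedSet, cls_mem_acceptedSet,
    ← accepts_smul_iff γ π, smul_inv_smul]

/-- The map that sends a state to the bar language it accepts. -/
def behaviour : X →[FinPerm A] Pfs A (BarClass A) where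
  toFun x := ⟨acceptedSet γ x, by
    obtain ⟨s, hs⟩ := IsNominal.exists_supports (A := A) x
    exact ⟨s, fun π hπ => by rw [smul_acceptedSet, hs π hπ]⟩⟩
  map_smul' π x := Subtype.ext (smul_acceptedSet γ π x).symm

theorem cls_mem_behaviour {w : BarString A} {x : X} :
    cls w ∈ behaviour γ x ↔ Accepts γ w x :=
  cls_mem_acceptedSet γ

theorem languageStr_behaviour (x : X) : languageStr A (behaviour γ x) =
    ((γ x).1, Exp.map (behaviour γ) (γ x).2.1, Abs.map (behaviour γ) (γ x).2.2) := by
  refine Prod.ext (Two.ext_one ?_) (Prod.ext (Exp.ext fun a => Pfs.ext ?_) ?_)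
  · exact acceptsEmpty_eq_one.trans (cls_mem_behaviour γ)
  · rintro ⟨w⟩
    exact cls_mem_deriv.trans ((cls_mem_behaviour γ).trans
      (cls_mem_behaviour γ (w := w) (x := (γ x).2.1 a)).symm)
  · obtain ⟨c, y, -, cx, -, e⟩ := exists_eq_abs_of_fresh (γ x).2.2 ∅ x x
    change barDeriv (behaviour γ x) = Abs.map (behaviour γ) (γ x).2.2
    -- An equivariant map preserves freshness, so `c` is also a legitimate bound name for the
    -- language of `x`.
    rw [barDeriv_eq (cx.map (behaviour γ)), e, Abs.map_abs]
    refine congrArg (abs c) (Pfs.ext ?_)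
    rintro ⟨w⟩
    exact cls_mem_deriv.trans ((cls_mem_behaviour γ).trans
      ((accepts_bar_self_iff γ e).trans (cls_mem_behaviour γ).symm))

theorem eq_behaviour (g : X →[FinPerm A] Pfs A (BarClass A))
    (hg : ∀ x, languageStr A (g x) = ((γ x).1, Exp.map g (γ x).2.1, Abs.map g (γ x).2.2)) :
    g = behaviour γ := by
  suffices h : ∀ (w : BarString A) (x : X), cls w ∈ g x ↔ Accepts γ w x by
    refine DFunLike.ext _ _ fun x => Pfs.ext ?_
    rintro ⟨w⟩
    exact (h w x).trans (cls_mem_behaviour γ).symm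
  intro w
  induction w with
  | nil =>
    intro x
    have h1 : acceptsEmpty (g x) = (γ x).1 := congrArg Prod.fst (hg x)
    rw [← acceptsEmpty_eq_one, h1]
    rfl
  | cons σ w ih =>
    intro x
    cases σ with
    | name a =>
      have h1 : deriv (.name a) (g x) = g ((γ x).2.1 a) :=
        congrArg (fun p => p.2.1 a) (hg x)
      rw [← cls_mem_deriv, h1]
      exact ih _
    | bar a =>
      obtain ⟨c, y, ca, cx, cw, e⟩ := exists_eq_abs_of_fresh (γ x).2.2 {a} x w
      rw [Finset.mem_singleton] at ca
      have h1 : barDeriv (g x) = Abs.map g (γ x).2.2 := congrArg (fun p => p.2.2) (hg x)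
      rw [barDeriv_eq (cx.map g), e, Abs.map_abs] at h1
      -- Since `c` is fresh for both `x` and `w`, the word becomes `|c((a c)w)` and the
      -- `|c`-derivative of `g x` is `g y`. The induction hypothesis is used at the state `(a c) •
      -- y`, and equivariance of `g` moves the swap onto the word.
      rw [accepts_bar_iff γ ca cw e, cls_bar_eq ca cw, ← cls_mem_deriv, abs_right_injective h1,
        ← ih, map_smul, ← smul_cls, ← Pfs.smul_mem_smul (swap a c), swap_smul_swap_smul]

end Behaviour

end Nominal

open Nominal in
/-- The nominal set of bar languages, with the structure map
`S ↦ ([ε] ∈ S, a ↦ S_a, ⟨a⟩{[w] | [|aw] ∈ S} for a fresh)`, is a terminal `G`-coalgebra. -/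
theorem mainTheorem9 (A : Type u) [Countable A] [Infinite A] :
    ∃ τ : barLanguages A ⟶ (G A).obj (barLanguages A),
      (∀ S : Pfs A (BarClass A), ∃ (b : Two) (f : Exp A (Pfs A (BarClass A)))
          (y : Abs A (Pfs A (BarClass A))),
        τ S = (b, f, y) ∧
        (b = Two.one ↔ cls [] ∈ S) ∧
        (∀ a : A, f a = deriv (BarLetter.name a) S) ∧
        (∀ a : A, Fresh a S → y = abs a (deriv (BarLetter.bar a) S))) ∧
      Nonempty (Limits.IsTerminal (⟨barLanguages A, τ⟩ : Endofunctor.Coalgebra (G A))) := by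
  refine ⟨languageStr A, fun S => ⟨acceptsEmpty S, nameDeriv S, barDeriv S, rfl,
    acceptsEmpty_eq_one, fun _ => rfl, fun _ => barDeriv_eq⟩, ⟨?_⟩⟩
  refine Limits.IsTerminal.ofUniqueHom
    (fun C => ⟨behaviour (A := A) (X := C.V) C.str, ?_⟩) fun C g => ?_
  · refine DFunLike.ext (F := C.V →[FinPerm A] _) _ _ fun x => ?_
    exact (languageStr_behaviour (A := A) (X := C.V) C.str x).symm
  · refine Endofunctor.Coalgebra.Hom.ext ?_
    refine eq_behaviour (A := A) (X := C.V) C.str g.f fun x => ?_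
    exact (DFunLike.congr_fun (F := C.V →[FinPerm A] _) g.h x).symm
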